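/- **Conventions.** For a poset $X$ and $S\subseteq X$ let ${\downarrow}S=\{x : x\le s\text{ for some }s\in S\}$. A *Priestley space* is a poset with a compact topology such that whenever $x\not\le y$ there is a clopen upset containing $x$ but not $y$; a *Priestley morphism* is a continuous order-preserving map. An *Esakia space* is a Priestley space in which ${\downarrow}U$ is clopen for each clopen $U$. A subset of an Esakia space is *E-constructible* if it is a finite union of sets $U\setminus V$ with $U,V$ open upsets. For a Priestley space $X$, $\mathsf{OpUp}(X)$ is the frame of open upsets of $X$. For a frame $L$, $K(L)$ is the set of compact elements of $L$; $L$ is a *Heyting frame* if it is algebraic (each element is a join of compact elements) and $K(L)$ is a Heyting subalgebra of $L$, i.e. contains $0,1$ and is closed under $\vee,\wedge$ and the implication $\to$ of $L$. For a bounded distributive lattice $A$, $\mathcal J(A)$ is the frame of ideals of $A$; for a bounded lattice homomorphism $h:A\to B$, $h^*:\mathcal J(A)\to\mathcal J(B)$ is the frame homomorphism $h^*(I)={\downarrow}h[I]$. **Categories.** - $\mathsf{HeytFrm}^+$: Heyting frames, with frame homomorphisms that preserve compact elements and the implication of arbitrary elements. - $\mathsf{HA}^+$: Heyting algebras, with bounded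 lattice homomorphisms $h:A\to B$ such that $h^*:\mathcal J(A)\to\mathcal J(B)$ preserves implication. - $\mathsf{ES}^+$: Esakia spaces, with Priestley morphisms $f:X\to Y$ such that $f^{-1}({\downarrow}\,\mathsf{cl}\,E)={\downarrow}\,\mathsf{cl}\,f^{-1}(E)$ for each E-constructible $E\subseteq Y$. **Theorem.** 1. $\mathsf{HeytFrm}^+$ is equivalent to $\mathsf{HA}^+$, via a functor $\mathsf{HA}^+\to\mathsf{HeytFrm}^+$ which, up to natural isomorphism of functors into frames, sends $A$ to $\mathcal J(A)$ and $h$ to $h^*$. 2. $\mathsf{HeytFrm}^+$ is dually equivalent to $\mathsf{ES}^+$, via a contravariant functor $\mathsf{ES}^+\to\mathsf{HeytFrm}^+$ which, up to natural isomorphism of functors into frames, sends $X$ to $\mathsf{OpUp}(X)$ and $f$ to $f^{-1}$. 3. For every Priestley morphism $f:X\to Y$ between Esakia spaces, $f^{-1}:\mathsf{OpUp}(Y)\to\mathsf{OpUp}(X)$ preserves implication if and only if $f^{-1}({\downarrow}\,\mathsf{cl}\,E)={\downarrow}\,\mathsf{cl}\,f^{-1}(E)$ for each E-constructible $E\subseteq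 Y$. -/

import Mathlib

open CategoryTheory

universe u v

namespace HeytingFrames

/-! ### Heyting frames -/

/-- A Heyting frame: a coherent frame `L` (every element is a join of compact elements, and the
set `K(L)` of compact elements is a bounded sublattice of `L`) such that `K(L)` is moreover closed
under the implication of `L`; that is, `K(L)` is a Heyting subalgebra of `L`. -/
class IsHeytingFrame (L : Type u) [Order.Frame L] : Prop extends IsCompactlyGenerated L where
  bot_mem : IsCompactElement (⊥ : L)
  top_mem : IsCompactElement (⊤ : L)
  sup_mem : ∀ a b : L, IsCompactElement a → IsCompactElement b → IsCompactElement (a ⊔ b)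
  inf_mem : ∀ a b : L, IsCompactElement a → IsCompactElement b → IsCompactElement (a ⊓ b)
  himp_mem : ∀ a b : L, IsCompactElement a → IsCompactElement b → IsCompactElement (a ⇨ b)

/-- Objects of the category `HeytFrm⁺`: Heyting frames. -/
structure HeytFrmPlus where
  carrier : Type u
  [frame : Order.Frame carrier]
  [isHeytingFrame : IsHeytingFrame carrier]

attribute [instance] HeytFrmPlus.frame HeytFrmPlus.isHeytingFrame

namespace HeytFrmPlus

/-- Morphisms of `HeytFrm⁺`: frame homomorphisms which preserve compact elements and the
implication of arbitrary elements. -/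
@[ext]
structure Hom (L M : HeytFrmPlus.{u}) where
  toFrameHom : FrameHom L.carrier M.carrier
  map_compact : ∀ a : L.carrier, IsCompactElement a → IsCompactElement (toFrameHom a)
  map_himp : ∀ a b : L.carrier, toFrameHom (a ⇨ b) = toFrameHom a ⇨ toFrameHom b

instance : Category HeytFrmPlus.{u} where
  Hom := Hom
  id L := ⟨FrameHom.id _, fun _ h => h, fun _ _ => rfl⟩
  comp f g :=
    ⟨g.toFrameHom.comp f.toFrameHom, fun a h => g.map_compact _ (f.map_compact a h), fun a b => by
      simp only [FrameHom.comp_apply, f.map_himp, g.map_himp]⟩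

/-- The forgetful functor to the category of frames. -/
def forgetToFrm : HeytFrmPlus.{u} ⥤ Frm.{u} where
  obj L := Frm.of L.carrier
  map f := Frm.ofHom f.toFrameHom

end HeytFrmPlus

/-! ### The frame of ideals and the category `HA⁺` -/

section Ideals

variable {A : Type u} {B : Type v} [DistribLattice A] [BoundedOrder A] [DistribLattice B]
  [BoundedOrder B]

/-- The ideal `{a | a ⊓ b ∈ J for all b ∈ I}`. -/
def idealHimp (I J : Order.Ideal A) : Order.Ideal A where
  carrier := {a | ∀ b ∈ I, a ⊓ b ∈ J}
  lower' := fun _ _ hyx hx b hb => J.lower (inf_le_inf_right b hyx) (hx b hb)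
  nonempty' := ⟨⊥, fun b _ => by rw [bot_inf_eq]; exact J.bot_mem⟩
  directed' := fun x hx y hy => ⟨x ⊔ y, fun b hb => by
    rw [inf_sup_right]
    exact Order.Ideal.sup_mem (hx b hb) (hy b hb), le_sup_left, le_sup_right⟩

theorem le_idealHimp_iff (I J N : Order.Ideal A) : N ≤ idealHimp I J ↔ N ⊓ I ≤ J := by
  constructor
  · intro h x hx
    have := h hx.1 x hx.2
    rwa [inf_idem] at this
  · intro h x hx b hb
    exact h ⟨N.lower inf_le_left hx, I.lower inf_le_right hb⟩

/-- The frame of ideals of a bounded distributive lattice (ordered by inclusion). -/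
instance idealFrame : Order.Frame (Order.Ideal A) where
  __ := (inferInstance : CompleteLattice (Order.Ideal A))
  himp := idealHimp
  le_himp_iff N I J := le_idealHimp_iff I J N
  compl I := idealHimp I ⊥
  himp_bot _ := rfl

/-- `h^*(I) = ↓h[I]`, the downset generated by the image of the ideal `I`. -/
def idealMap (h : BoundedLatticeHom A B) (I : Order.Ideal A) : Order.Ideal B where
  carrier := {b | ∃ a ∈ I, b ≤ h a}
  lower' := fun _ _ hyx ⟨a, ha, hx⟩ => ⟨a, ha, le_trans hyx hx⟩
  nonempty' := ⟨⊥, ⊥, I.bot_mem, bot_le⟩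
  directed' := fun x ⟨a, ha, hx⟩ y ⟨b, hb, hy⟩ =>
    ⟨x ⊔ y, ⟨a ⊔ b, Order.Ideal.sup_mem ha hb, by
      rw [map_sup]; exact sup_le_sup hx hy⟩, le_sup_left, le_sup_right⟩

theorem mem_idealMap {h : BoundedLatticeHom A B} {I : Order.Ideal A} {b : B} :
    b ∈ idealMap h I ↔ ∃ a ∈ I, b ≤ h a := Iff.rfl

/-- The preimage of an ideal (only used to see that `idealMap` preserves joins). -/
def idealComap (h : BoundedLatticeHom A B) (J : Order.Ideal B) : Order.Ideal A where
  carrier := {a | h a ∈ J}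
  lower' := fun _ _ hyx hx => J.lower (OrderHomClass.mono h hyx) hx
  nonempty' := ⟨⊥, by rw [Set.mem_ofPred_eq, map_bot]; exact J.bot_mem⟩
  directed' := fun x hx y hy => ⟨x ⊔ y, by
    rw [Set.mem_ofPred_eq, map_sup]; exact Order.Ideal.sup_mem hx hy, le_sup_left, le_sup_right⟩

theorem idealMap_gc (h : BoundedLatticeHom A B) :
    GaloisConnection (idealMap h) (idealComap h) := by
  intro I J
  constructor
  · intro H a ha
    exact H ⟨a, ha, le_rfl⟩
  · rintro H b ⟨a, ha, hb⟩
    exact J.lower hb (H ha)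

/-- The map `h^*` as a frame homomorphism between the frames of ideals. -/
def idealMapHom (h : BoundedLatticeHom A B) : FrameHom (Order.Ideal A) (Order.Ideal B) where
  toFun := idealMap h
  map_inf' I J := by
    apply le_antisymm
    · exact le_inf ((idealMap_gc h).monotone_l inf_le_left)
        ((idealMap_gc h).monotone_l inf_le_right)
    · rintro b ⟨⟨x, hx, hbx⟩, ⟨y, hy, hby⟩⟩
      exact ⟨x ⊓ y, ⟨I.lower inf_le_left hx, J.lower inf_le_right hy⟩, by
        rw [map_inf]; exact le_inf hbx hby⟩
  map_top' := by
    refine top_le_iff.mp fun b _ => ⟨⊤, trivial, ?_⟩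
    rw [map_top]; exact le_top
  map_sSup' S := by rw [(idealMap_gc h).l_sSup, sSup_image]

theorem idealMap_id (I : Order.Ideal A) : idealMap (BoundedLatticeHom.id A) I = I := by
  ext b
  exact ⟨fun ⟨_, ha, hb⟩ => I.lower hb ha, fun hb => ⟨b, hb, le_rfl⟩⟩

theorem idealMap_comp {C : Type*} [DistribLattice C] [BoundedOrder C] (g : BoundedLatticeHom B C)
    (h : BoundedLatticeHom A B) (I : Order.Ideal A) :
    idealMap (g.comp h) I = idealMap g (idealMap h I) := by
  ext c
  constructor
  · rintro ⟨a, ha, hc⟩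
    exact ⟨h a, ⟨a, ha, le_rfl⟩, hc⟩
  · rintro ⟨b, ⟨a, ha, hb⟩, hc⟩
    exact ⟨a, ha, hc.trans (OrderHomClass.mono g hb)⟩

end Ideals

/-- Objects of the category `HA⁺`: Heyting algebras. -/
structure HAPlus where
  carrier : Type u
  [heytingAlgebra : HeytingAlgebra carrier]

attribute [instance] HAPlus.heytingAlgebra

namespace HAPlus

/-- Morphisms of `HA⁺`: bounded lattice homomorphisms `h` such that the frame homomorphism `h^*`
between the frames of ideals preserves implication. -/
@[ext]
structure Hom (A B : HAPlus.{u}) where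
  toBoundedLatticeHom : BoundedLatticeHom A.carrier B.carrier
  idealMap_himp : ∀ I J : Order.Ideal A.carrier, idealMap toBoundedLatticeHom (I ⇨ J) =
    idealMap toBoundedLatticeHom I ⇨ idealMap toBoundedLatticeHom J

instance : Category HAPlus.{u} where
  Hom := Hom
  id A := ⟨BoundedLatticeHom.id _, fun I J => by simp only [idealMap_id]⟩
  comp f g := ⟨g.toBoundedLatticeHom.comp f.toBoundedLatticeHom, fun I J => by
    simp only [idealMap_comp, f.idealMap_himp, g.idealMap_himp]⟩

/-- The functor sending `A` to its frame of ideals and `h` to `h^*`. -/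
def idealFunctor : HAPlus.{u} ⥤ Frm.{u} where
  obj A := Frm.of (Order.Ideal A.carrier)
  map f := Frm.ofHom (idealMapHom f.toBoundedLatticeHom)
  map_id A := by
    refine Frm.hom_ext (FrameHom.ext fun I => ?_)
    exact idealMap_id I
  map_comp f g := by
    refine Frm.hom_ext (FrameHom.ext fun I => ?_)
    exact idealMap_comp g.toBoundedLatticeHom f.toBoundedLatticeHom I

end HAPlus

/-! ### The frame of open upsets -/

/-- The type of open upsets of an ordered topological space. -/
@[ext]
structure OpUp (X : Type u) [TopologicalSpace X] [Preorder X] : Type u where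
  carrier : Set X
  isOpen : IsOpen carrier
  isUpperSet : IsUpperSet carrier

section OpUp

variable {X : Type u} {Y : Type v} [TopologicalSpace X] [PartialOrder X] [TopologicalSpace Y]
  [PartialOrder Y]

/-- Open upsets are ordered by inclusion. -/
instance : PartialOrder (OpUp X) where
  le U V := U.carrier ⊆ V.carrier
  le_refl _ := subset_rfl
  le_trans _ _ _ h₁ h₂ := Set.Subset.trans h₁ h₂
  le_antisymm _ _ h₁ h₂ := OpUp.ext (Set.Subset.antisymm h₁ h₂)

instance : SupSet (OpUp X) where
  sSup S := ⟨⋃ U ∈ S, U.carrier, isOpen_biUnion fun U _ => U.isOpen,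
    isUpperSet_iUnion₂ fun U _ => U.isUpperSet⟩

theorem OpUp.isLUB_sSup (S : Set (OpUp X)) : IsLUB S (sSup S) :=
  ⟨fun _ hU => Set.subset_biUnion_of_mem (u := fun U : OpUp X => U.carrier) hU,
    fun _ hV => Set.iUnion₂_subset fun _ hU => hV hU⟩

/-- The complete lattice of open upsets: finite meets are intersections, joins are unions. -/
instance : CompleteLattice (OpUp X) where
  __ := completeLatticeOfSup (OpUp X) OpUp.isLUB_sSup
  top := ⟨Set.univ, isOpen_univ, isUpperSet_univ⟩
  le_top _ := Set.subset_univ _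
  inf U V := ⟨U.carrier ∩ V.carrier, U.isOpen.inter V.isOpen, U.isUpperSet.inter V.isUpperSet⟩
  inf_le_left _ _ := Set.inter_subset_left
  inf_le_right _ _ := Set.inter_subset_right
  le_inf _ _ _ h₁ h₂ := Set.subset_inter h₁ h₂

/-- The frame of open upsets; `U ⇨ V` is the largest open upset `W` with `W ∩ U ⊆ V`. -/
instance : Order.Frame (OpUp X) := Order.Frame.ofMinimalAxioms
  { inf_sSup_le_iSup_inf := fun U S x hx => by
      obtain ⟨hU, hS⟩ := hx
      obtain ⟨V, hV, hxV⟩ := Set.mem_iUnion₂.mp hS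
      exact (le_iSup₂ (f := fun V (_ : V ∈ S) => U ⊓ V) V hV) ⟨hU, hxV⟩ }

/-- The frame homomorphism `f⁻¹ : OpUp(Y) → OpUp(X)` of a continuous order-preserving `f`. -/
def OpUp.comap (f : X →Co Y) : FrameHom (OpUp Y) (OpUp X) where
  toFun U := ⟨f ⁻¹' U.carrier, U.isOpen.preimage f.continuous_toFun,
    U.isUpperSet.preimage f.monotone'⟩
  map_inf' _ _ := rfl
  map_top' := rfl
  map_sSup' S := OpUp.ext (by
    change f ⁻¹' (⋃ U ∈ S, U.carrier) = ⋃ U ∈ (_ '' S : Set (OpUp X)), U.carrier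
    rw [Set.biUnion_image, Set.preimage_iUnion₂])

end OpUp

/-! ### Esakia spaces -/

/-- A Priestley space (compact, with the Priestley separation axiom) in which the downset generated
by a clopen set is clopen. -/
class EsakiaSpace (X : Type u) [TopologicalSpace X] [PartialOrder X] : Prop
    extends CompactSpace X, PriestleySpace X where
  isClopen_lowerClosure : ∀ U : Set X, IsClopen U → IsClopen (lowerClosure U : Set X)

/-- Esakia-constructible sets: finite unions of sets `U \ V` with `U`, `V` open upsets. -/
def IsEConstructible {X : Type u} [TopologicalSpace X] [PartialOrder X] (E : Set X) : Prop :=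
  ∃ S : Set (Set X), S.Finite ∧
    (∀ D ∈ S, ∃ U V : Set X, IsOpen U ∧ IsUpperSet U ∧ IsOpen V ∧ IsUpperSet V ∧ D = U \ V) ∧
    E = ⋃₀ S

/-- `f⁻¹(↓cl E) = ↓cl f⁻¹(E)` for each Esakia-constructible set `E`. -/
def CommutesWithClosure {X : Type u} {Y : Type v} [TopologicalSpace X] [PartialOrder X]
    [TopologicalSpace Y] [PartialOrder Y] (f : X → Y) : Prop :=
  ∀ E : Set Y, IsEConstructible E →
    f ⁻¹' (lowerClosure (closure E) : Set Y) = (lowerClosure (closure (f ⁻¹' E)) : Set X)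

theorem IsEConstructible.preimage {X : Type u} {Y : Type v} [TopologicalSpace X] [PartialOrder X]
    [TopologicalSpace Y] [PartialOrder Y] (f : X →Co Y) {E : Set Y} (hE : IsEConstructible E) :
    IsEConstructible (f ⁻¹' E) := by
  obtain ⟨S, hS, hD, rfl⟩ := hE
  refine ⟨Set.preimage f '' S, hS.image _, ?_, ?_⟩
  · rintro _ ⟨D, hDS, rfl⟩
    obtain ⟨U, V, hU, hU', hV, hV', rfl⟩ := hD D hDS
    exact ⟨f ⁻¹' U, f ⁻¹' V, hU.preimage f.continuous_toFun, hU'.preimage f.monotone',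
      hV.preimage f.continuous_toFun, hV'.preimage f.monotone', Set.preimage_sdiff ..⟩
  · rw [Set.preimage_sUnion, Set.sUnion_image]

/-- Objects of the category `ES⁺`: Esakia spaces. -/
structure ESPlus where
  carrier : Type u
  [topologicalSpace : TopologicalSpace carrier]
  [partialOrder : PartialOrder carrier]
  [esakiaSpace : EsakiaSpace carrier]

attribute [instance] ESPlus.topologicalSpace ESPlus.partialOrder ESPlus.esakiaSpace

namespace ESPlus

/-- Morphisms of `ES⁺`: Priestley morphisms (continuous order-preserving maps) `f` with
`f⁻¹(↓cl E) = ↓cl f⁻¹(E)` for each Esakia-constructible set `E`. -/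
@[ext]
structure Hom (X Y : ESPlus.{u}) where
  toContinuousOrderHom : X.carrier →Co Y.carrier
  commutes : CommutesWithClosure toContinuousOrderHom

instance : Category ESPlus.{u} where
  Hom := Hom
  id X := ⟨ContinuousOrderHom.id _, fun _ _ => rfl⟩
  comp f g := ⟨g.toContinuousOrderHom.comp f.toContinuousOrderHom, fun E hE => by
    rw [ContinuousOrderHom.coe_comp, Set.preimage_comp, g.commutes E hE,
      f.commutes _ (hE.preimage g.toContinuousOrderHom), Set.preimage_comp]⟩

/-- The contravariant functor sending `X` to `OpUp(X)` and `f` to `f⁻¹`. -/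
def opUpFunctor : ESPlus.{u}ᵒᵖ ⥤ Frm.{u} where
  obj X := Frm.of (OpUp X.unop.carrier)
  map f := Frm.ofHom (OpUp.comap f.unop.toContinuousOrderHom)

end ESPlus

end HeytingFrames

namespace HeytingFrames

/-! ### Isomorphisms of Heyting frames -/

/-! Both equivalences come from one pattern: a functor into `HeytFrmPlus` is shown to be full,
faithful and essentially surjective, and compact elements carry all the information.

In the frame of ideals the compact elements are the principal ideals, a copy of `A`. A frame
homomorphism preserving them therefore restricts to a lattice homomorphism and is determined by it,
since every ideal is a join of principal ones. Conversely, an algebraic frame whose compact elements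
form a sublattice is recovered as their ideals (`compactsBelowIso`).

In the frame of open upsets of a Priestley space the compact elements are the clopen upsets. They
separate points, which gives faithfulness; compactness turns a frame homomorphism preserving them
into a point map (`OpUp.exists_comap_eq`), which gives fullness. Essential surjectivity combines
`compactsBelowIso` with `PrimeSpec.openOfIdealIso`, the prime filter representation of ideals as
open upsets.

The morphism conditions match because the complement of `U ⇨ V` is `↓cl (U \ V)`
(`OpUp.carrier_himp`): preserving implication is the closure condition for the single differences `U
\ V`, and this extends to finite unions because closure, `↓` and preimage all commute with them. -/

theorem isCompactElement_orderIso {L M : Type*} [CompleteLattice L] [CompleteLattice M]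
    (e : L ≃o M) {a : L} (ha : IsCompactElement a) : IsCompactElement (e a) := by
  intro s u hs hd hu hau
  obtain ⟨x, ⟨y, hy, rfl⟩, hx⟩ := ha (e.symm '' s) (e.symm u) (hs.image _)
    (directedOn_image.mpr fun x hx y hy => by
      obtain ⟨z, hz, h₁, h₂⟩ := hd x hx y hy
      exact ⟨z, hz, e.symm.monotone h₁, e.symm.monotone h₂⟩)
    (e.symm.isLUB_image'.mpr hu) (e.le_symm_apply.mpr hau)
  exact ⟨y, hy, e.le_symm_apply.mp hx⟩

/-- An order isomorphism of Heyting frames, as a morphism of `HeytFrm⁺`. -/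
def HeytFrmPlus.Hom.ofOrderIso {L M : HeytFrmPlus.{u}} (e : L.carrier ≃o M.carrier) :
    HeytFrmPlus.Hom L M where
  toFrameHom := (e : FrameHom L.carrier M.carrier)
  map_compact _ ha := isCompactElement_orderIso e ha
  map_himp a b := HeytingHomClass.map_himp e a b

theorem HeytFrmPlus.hom_ext {L M : HeytFrmPlus.{u}} {f g : L ⟶ M}
    (h : ∀ a, f.toFrameHom a = g.toFrameHom a) : f = g :=
  HeytFrmPlus.Hom.ext (FrameHom.ext h)

/-- An order isomorphism of Heyting frames is an isomorphism in `HeytFrm⁺`. -/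
def HeytFrmPlus.isoOfOrderIso {L M : HeytFrmPlus.{u}} (e : L.carrier ≃o M.carrier) : L ≅ M where
  hom := HeytFrmPlus.Hom.ofOrderIso e
  inv := HeytFrmPlus.Hom.ofOrderIso e.symm
  hom_inv_id := HeytFrmPlus.hom_ext fun a => e.symm_apply_apply a
  inv_hom_id := HeytFrmPlus.hom_ext fun a => e.apply_symm_apply a

/-! ### The frame of ideals is a Heyting frame -/

section Ideals

variable {A : Type u} {B : Type v} [DistribLattice A] [BoundedOrder A] [DistribLattice B]
  [BoundedOrder B]

open Order (Ideal)

/-- The union of a nonempty directed family of ideals is already an ideal, so it is the join. -/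
theorem mem_ideal_sSup_of_directedOn {S : Set (Ideal A)} (hS : S.Nonempty)
    (hd : DirectedOn (· ≤ ·) S) {a : A} : a ∈ sSup S ↔ ∃ I ∈ S, a ∈ I := by
  constructor
  · intro ha
    let J : Ideal A :=
      { carrier := {x | ∃ I ∈ S, x ∈ I}
        lower' := fun x y hyx ⟨I, hI, hx⟩ => ⟨I, hI, I.lower hyx hx⟩
        nonempty' := by
          obtain ⟨I, hI⟩ := hS
          exact ⟨⊥, I, hI, I.bot_mem⟩
        directed' := by
          rintro x ⟨I, hI, hx⟩ y ⟨I', hI', hy⟩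
          obtain ⟨K, hK, h₁, h₂⟩ := hd I hI I' hI'
          exact ⟨x ⊔ y, ⟨K, hK, Order.Ideal.sup_mem (h₁ hx) (h₂ hy)⟩, le_sup_left, le_sup_right⟩ }
    have h : sSup S ≤ J := sSup_le fun I hI x hx => ⟨I, hI, hx⟩
    exact h ha
  · rintro ⟨I, hI, ha⟩
    exact (le_sSup hI : I ≤ sSup S) ha

theorem directedOn_principal_image {A : Type*} [DistribLattice A] (I : Ideal A) :
    DirectedOn (· ≤ ·) (Ideal.principal '' (I : Set A)) := by
  rintro _ ⟨x, hx, rfl⟩ _ ⟨y, hy, rfl⟩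
  exact ⟨_, ⟨x ⊔ y, Order.Ideal.sup_mem hx hy, rfl⟩,
    Ideal.principal_le_iff.mpr (Ideal.mem_principal.mpr le_sup_left),
    Ideal.principal_le_iff.mpr (Ideal.mem_principal.mpr le_sup_right)⟩

theorem sSup_principal_image (I : Ideal A) : sSup (Ideal.principal '' (I : Set A)) = I := by
  apply le_antisymm
  · apply sSup_le
    rintro _ ⟨x, hx, rfl⟩
    exact Ideal.principal_le_iff.mpr hx
  · intro x hx
    exact le_sSup (Set.mem_image_of_mem Ideal.principal hx) Ideal.mem_principal_self

theorem isCompactElement_principal (a : A) : IsCompactElement (Ideal.principal a) := by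
  rw [CompleteLattice.isCompactElement_iff_le_of_directed_sSup_le]
  intro S hS hd h
  obtain ⟨I, hI, ha⟩ := (mem_ideal_sSup_of_directedOn hS hd).mp (Ideal.principal_le_iff.mp h)
  exact ⟨I, hI, Ideal.principal_le_iff.mpr ha⟩

/-- An ideal is the directed join of the principal ideals inside it, so a compact one lies below,
hence equals, one of these. -/
theorem isCompactElement_ideal_iff {I : Ideal A} :
    IsCompactElement I ↔ ∃ a, I = Ideal.principal a := by
  constructor
  · intro h
    rw [CompleteLattice.isCompactElement_iff_le_of_directed_sSup_le] at h
    obtain ⟨_, ⟨a, ha, rfl⟩, hI⟩ := h _ (I.nonempty.image _) (directedOn_principal_image I)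
      (sSup_principal_image I).ge
    exact ⟨a, hI.antisymm (Ideal.principal_le_iff.mpr ha)⟩
  · rintro ⟨a, rfl⟩
    exact isCompactElement_principal a

theorem principal_injective {A : Type*} [PartialOrder A] :
    Function.Injective (Ideal.principal : A → Ideal A) := by
  intro a b h
  exact le_antisymm (Ideal.mem_principal.mp (h ▸ Ideal.mem_principal_self))
    (Ideal.mem_principal.mp (h ▸ Ideal.mem_principal_self))

theorem principal_sup (a b : A) :
    Ideal.principal (a ⊔ b) = Ideal.principal a ⊔ Ideal.principal b := by
  apply le_antisymm
  · rw [Ideal.principal_le_iff, Ideal.mem_sup]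
    exact ⟨a, Ideal.mem_principal_self, b, Ideal.mem_principal_self, le_rfl⟩
  · exact sup_le (Ideal.principal_le_iff.mpr (Ideal.mem_principal.mpr le_sup_left))
      (Ideal.principal_le_iff.mpr (Ideal.mem_principal.mpr le_sup_right))

theorem principal_inf (a b : A) :
    Ideal.principal (a ⊓ b) = Ideal.principal a ⊓ Ideal.principal b := by
  ext x
  exact le_inf_iff

theorem principal_himp {A : Type u} [HeytingAlgebra A] (a b : A) :
    Ideal.principal (a ⇨ b) = Ideal.principal a ⇨ Ideal.principal b := by
  apply eq_of_forall_le_iff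
  intro I
  rw [le_himp_iff]
  constructor
  · intro h x hx
    exact (le_inf (h hx.1) hx.2).trans (le_himp_iff.mp le_rfl)
  · intro h x hx
    refine le_himp_iff.mpr (h ⟨I.lower inf_le_left hx, ?_⟩)
    exact (inf_le_right : x ⊓ a ≤ a)

theorem idealMap_principal (h : BoundedLatticeHom A B) (a : A) :
    idealMap h (Ideal.principal a) = Ideal.principal (h a) := by
  ext b
  exact ⟨fun ⟨_, hx, hb⟩ => hb.trans (OrderHomClass.mono h hx), fun hb => ⟨a, le_rfl, hb⟩⟩

theorem frameHom_ext_principal {M : Type*} [CompleteLattice M] {f g : FrameHom (Ideal A) M}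
    (h : ∀ a, f (Ideal.principal a) = g (Ideal.principal a)) (I : Ideal A) : f I = g I := by
  rw [← sSup_principal_image I, map_sSup, map_sSup, Set.image_image, Set.image_image]
  simp only [h]

instance {A : Type u} [HeytingAlgebra A] : IsHeytingFrame (Ideal A) where
  exists_sSup_eq I := ⟨_, by
    rintro _ ⟨a, -, rfl⟩
    exact isCompactElement_principal a, sSup_principal_image I⟩
  bot_mem := isCompactElement_ideal_iff.mpr ⟨⊥, Ideal.principal_bot.symm⟩
  top_mem := isCompactElement_ideal_iff.mpr ⟨⊤, Ideal.principal_top.symm⟩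
  sup_mem I J hI hJ := by
    obtain ⟨a, rfl⟩ := isCompactElement_ideal_iff.mp hI
    obtain ⟨b, rfl⟩ := isCompactElement_ideal_iff.mp hJ
    exact isCompactElement_ideal_iff.mpr ⟨_, (principal_sup a b).symm⟩
  inf_mem I J hI hJ := by
    obtain ⟨a, rfl⟩ := isCompactElement_ideal_iff.mp hI
    obtain ⟨b, rfl⟩ := isCompactElement_ideal_iff.mp hJ
    exact isCompactElement_ideal_iff.mpr ⟨_, (principal_inf a b).symm⟩
  himp_mem I J hI hJ := by
    obtain ⟨a, rfl⟩ := isCompactElement_ideal_iff.mp hI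
    obtain ⟨b, rfl⟩ := isCompactElement_ideal_iff.mp hJ
    exact isCompactElement_ideal_iff.mpr ⟨_, (principal_himp a b).symm⟩

/-- A frame homomorphism between frames of ideals which preserves compact elements comes from a
bounded lattice homomorphism. -/
theorem exists_idealMapHom_eq (φ : FrameHom (Ideal A) (Ideal B))
    (hφ : ∀ I, IsCompactElement I → IsCompactElement (φ I)) :
    ∃ h : BoundedLatticeHom A B, ∀ I, idealMap h I = φ I := by
  -- `h a` is the generator of the compact, hence principal, ideal `φ (↓a)`. Generators are unique,
  -- so `h` inherits the lattice operations from `φ`.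
  choose h hh using fun a => isCompactElement_ideal_iff.mp (hφ _ (isCompactElement_principal a))
  refine ⟨{ toFun := h, map_sup' := ?_, map_inf' := ?_, map_top' := ?_, map_bot' := ?_ },
    fun I => ?_⟩
  · intro a b
    apply principal_injective
    rw [principal_sup, ← hh, ← hh, ← hh, principal_sup, map_sup]
  · intro a b
    apply principal_injective
    rw [principal_inf, ← hh, ← hh, ← hh, principal_inf, map_inf]
  · apply principal_injective
    rw [← hh, Ideal.principal_top, Ideal.principal_top]
    exact map_top φ
  · apply principal_injective
    rw [← hh, Ideal.principal_bot, Ideal.principal_bot]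
    exact map_bot φ
  · exact frameHom_ext_principal (f := idealMapHom _) (g := φ)
      (fun a => (idealMap_principal _ a).trans (hh a).symm) I

end Ideals

/-! ### Ideals as a fully faithful functor on Heyting algebras -/

namespace HAPlus

/-- The functor `HA⁺ ⥤ HeytFrm⁺` sending `A` to its frame of ideals and `h` to `h^*`. -/
def toHeytFrmPlus : HAPlus.{u} ⥤ HeytFrmPlus.{u} where
  obj A := ⟨Order.Ideal A.carrier⟩
  map f := ⟨idealMapHom f.toBoundedLatticeHom, fun I hI => by
    obtain ⟨a, rfl⟩ := isCompactElement_ideal_iff.mp hI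
    exact isCompactElement_ideal_iff.mpr ⟨_, idealMap_principal _ a⟩, f.idealMap_himp⟩
  map_id _ := HeytFrmPlus.hom_ext idealMap_id
  map_comp f g := HeytFrmPlus.hom_ext
    (idealMap_comp g.toBoundedLatticeHom f.toBoundedLatticeHom)

instance : toHeytFrmPlus.{u}.Faithful where
  map_injective {A B} f g h := by
    refine HAPlus.Hom.ext (BoundedLatticeHom.ext fun a => principal_injective ?_)
    rw [← idealMap_principal, ← idealMap_principal]
    exact congrArg (fun k : HeytFrmPlus.Hom _ _ => k.toFrameHom (Order.Ideal.principal a)) h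

instance : toHeytFrmPlus.{u}.Full where
  map_surjective {A B} φ := by
    obtain ⟨h, hh⟩ := exists_idealMapHom_eq φ.toFrameHom φ.map_compact
    exact ⟨⟨h, fun I J => by rw [hh, hh, hh]; exact φ.map_himp I J⟩, HeytFrmPlus.hom_ext hh⟩

end HAPlus

/-! ### The Heyting algebra of compact elements -/

section Compacts

variable (L : Type u) [Order.Frame L] [IsHeytingFrame L]

/-- The compact elements of a Heyting frame. -/
abbrev Compacts := {a : L // IsCompactElement a}

instance : Lattice (Compacts L) :=
  Subtype.lattice (fun _ _ ha hb => IsHeytingFrame.sup_mem _ _ ha hb)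
    (fun _ _ ha hb => IsHeytingFrame.inf_mem _ _ ha hb)

instance : HeytingAlgebra (Compacts L) where
  top := ⟨⊤, IsHeytingFrame.top_mem⟩
  le_top a := le_top (a := a.1)
  bot := ⟨⊥, IsHeytingFrame.bot_mem⟩
  bot_le a := bot_le (a := a.1)
  himp a b := ⟨a.1 ⇨ b.1, IsHeytingFrame.himp_mem _ _ a.2 b.2⟩
  le_himp_iff a b c := le_himp_iff (a := a.1) (b := b.1) (c := c.1)
  compl a := ⟨a.1 ⇨ ⊥, IsHeytingFrame.himp_mem _ _ a.2 IsHeytingFrame.bot_mem⟩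
  himp_bot _ := rfl

/-- The ideal of compact elements below `a`. -/
def compactsBelow (a : L) : Order.Ideal (Compacts L) where
  carrier := {k | k.1 ≤ a}
  lower' _ _ hyx hx := le_trans hyx hx
  nonempty' := ⟨⊥, (bot_le : (⊥ : L) ≤ a)⟩
  directed' x hx y hy := ⟨x ⊔ y, (sup_le hx hy : x.1 ⊔ y.1 ≤ a), le_sup_left, le_sup_right⟩

theorem compactsBelow_le_iff {a b : L} : compactsBelow L a ≤ compactsBelow L b ↔ a ≤ b :=
  ⟨fun h => le_iff_compact_le_imp.mpr fun c hc hca => h (x := ⟨c, hc⟩) hca,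
    fun h _ hk => le_trans hk h⟩

/-- An ideal `I` is recovered from its join in `L`: the join is directed, so a compact element below
it is below a member of `I`. -/
theorem compactsBelow_surjective : Function.Surjective (compactsBelow L) := by
  intro I
  refine ⟨sSup (Subtype.val '' (I : Set (Compacts L))), ?_⟩
  apply le_antisymm
  · intro k hk
    obtain ⟨_, ⟨j, hj, rfl⟩, hkj⟩ := (CompleteLattice.isCompactElement_iff_le_of_directed_sSup_le _ k.1).mp k.2 _
      (I.nonempty.image _) (by
        rintro _ ⟨x, hx, rfl⟩ _ ⟨y, hy, rfl⟩
        obtain ⟨z, hz, h₁, h₂⟩ := I.directed x hx y hy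
        exact ⟨z, ⟨z, hz, rfl⟩, h₁, h₂⟩) hk
    exact I.lower hkj hj
  · intro k hk
    exact le_sSup ⟨k, hk, rfl⟩

/-- A Heyting frame is isomorphic to the frame of ideals of its compact elements. -/
noncomputable def compactsBelowIso : L ≃o Order.Ideal (Compacts L) :=
  RelIso.ofSurjective
    (OrderEmbedding.ofMapLEIff (compactsBelow L) fun _ _ => compactsBelow_le_iff L)
    (compactsBelow_surjective L)

end Compacts

instance : HAPlus.toHeytFrmPlus.{u}.EssSurj where
  mem_essImage L := ⟨⟨Compacts L.carrier⟩,
    ⟨HeytFrmPlus.isoOfOrderIso (compactsBelowIso L.carrier).symm⟩⟩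

instance : HAPlus.toHeytFrmPlus.{u}.IsEquivalence where

/-! ### Open upsets of Priestley spaces -/

section Priestley

variable {X : Type u} [TopologicalSpace X] [PartialOrder X]

/-- For `x ∉ ↓C`, the complements of the clopen upsets containing `x` cover `C`. This cover is
directed, so by compactness a single such upset misses `C`, and being an upset it also misses `↓C`.
-/
theorem isClosed_lowerClosure_of_isClosed [CompactSpace X] [PriestleySpace X] {C : Set X}
    (hC : IsClosed C) : IsClosed (lowerClosure C : Set X) := by
  rw [← isOpen_compl_iff, isOpen_iff_forall_mem_open]
  intro x hx
  have hle : ∀ c ∈ C, ¬ x ≤ c := fun c hc h => hx (mem_lowerClosure.mpr ⟨c, hc, h⟩)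
  let ι := {U : Set X // IsClopen U ∧ IsUpperSet U ∧ x ∈ U}
  have : Nonempty ι := ⟨⟨Set.univ, isClopen_univ, isUpperSet_univ, trivial⟩⟩
  obtain ⟨⟨U, hU, hU', hxU⟩, hCU⟩ := hC.isCompact.elim_directed_cover (fun U : ι => (U.1)ᶜ)
    (fun U => U.2.1.compl.isOpen)
    (fun c hc => by
      obtain ⟨U, hU, hU', hxU, hcU⟩ := exists_isClopen_upper_of_not_le (hle c hc)
      exact Set.mem_iUnion.mpr ⟨⟨U, hU, hU', hxU⟩, hcU⟩)
    (fun U V => ⟨⟨U.1 ∩ V.1, U.2.1.inter V.2.1, U.2.2.1.inter V.2.2.1, U.2.2.2, V.2.2.2⟩,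
      Set.compl_subset_compl.mpr Set.inter_subset_left,
      Set.compl_subset_compl.mpr Set.inter_subset_right⟩)
  refine ⟨U, fun y hy hyC => ?_, hU.isOpen, hxU⟩
  obtain ⟨c, hc, hyc⟩ := mem_lowerClosure.mp hyC
  exact hCU hc (hU' hyc hy)

theorem exists_isClopen_upper_subset [CompactSpace X] [PriestleySpace X] {U : Set X}
    (hU : IsOpen U) (hU' : IsUpperSet U) {x : X} (hx : x ∈ U) :
    ∃ V : Set X, IsClopen V ∧ IsUpperSet V ∧ x ∈ V ∧ V ⊆ U := by
  let ι := {V : Set X // IsClopen V ∧ IsUpperSet V ∧ x ∈ V}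
  have : Nonempty ι := ⟨⟨Set.univ, isClopen_univ, isUpperSet_univ, trivial⟩⟩
  obtain ⟨⟨V, hV, hV', hxV⟩, hUV⟩ := hU.isClosed_compl.isCompact.elim_directed_cover
    (fun V : ι => (V.1)ᶜ) (fun V => V.2.1.compl.isOpen)
    (fun c hc => by
      obtain ⟨V, hV, hV', hxV, hcV⟩ :=
        exists_isClopen_upper_of_not_le (fun h : x ≤ c => hc (hU' h hx))
      exact Set.mem_iUnion.mpr ⟨⟨V, hV, hV', hxV⟩, hcV⟩)
    (fun V W => ⟨⟨V.1 ∩ W.1, V.2.1.inter W.2.1, V.2.2.1.inter W.2.2.1, V.2.2.2, W.2.2.2⟩,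
      Set.compl_subset_compl.mpr Set.inter_subset_left,
      Set.compl_subset_compl.mpr Set.inter_subset_right⟩)
  exact ⟨V, hV, hV', hxV, Set.compl_subset_compl.mp hUV⟩

theorem OpUp.carrier_sSup (S : Set (OpUp X)) : (sSup S).carrier = ⋃ U ∈ S, U.carrier := rfl

theorem OpUp.carrier_bot : (⊥ : OpUp X).carrier = ∅ :=
  Set.subset_empty_iff.mp (bot_le (a := (⟨∅, isOpen_empty, isUpperSet_empty⟩ : OpUp X)))

theorem OpUp.carrier_sup (U V : OpUp X) : (U ⊔ V).carrier = U.carrier ∪ V.carrier := by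
  apply Set.Subset.antisymm
  · exact sup_le (c := (⟨_, U.isOpen.union V.isOpen, U.isUpperSet.union V.isUpperSet⟩ : OpUp X))
      Set.subset_union_left Set.subset_union_right
  · exact Set.union_subset (le_sup_left : U ≤ U ⊔ V) (le_sup_right : V ≤ U ⊔ V)

/-- The complement of `U ⇨ V` is the closed downset generated by `U \ V`. -/
theorem OpUp.carrier_himp [CompactSpace X] [PriestleySpace X] (U V : OpUp X) :
    (U ⇨ V).carrier = (lowerClosure (closure (U.carrier \ V.carrier)) : Set X)ᶜ := by
  let W : OpUp X := ⟨(lowerClosure (closure (U.carrier \ V.carrier)) : Set X)ᶜ,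
    (isClosed_lowerClosure_of_isClosed isClosed_closure).isOpen_compl,
    (lowerClosure (closure (U.carrier \ V.carrier))).lower.compl⟩
  apply Set.Subset.antisymm
  · have hd : closure (U.carrier \ V.carrier) ⊆ (U ⇨ V).carrierᶜ :=
      closure_minimal (fun x hx hx' => hx.2 ((himp_inf_le : (U ⇨ V) ⊓ U ≤ V) ⟨hx', hx.1⟩))
        (U ⇨ V).isOpen.isClosed_compl
    intro x hx hx'
    obtain ⟨y, hy, hxy⟩ := mem_lowerClosure.mp hx'
    exact hd hy ((U ⇨ V).isUpperSet hxy hx)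
  · refine (le_himp_iff.mpr ?_ : W ≤ U ⇨ V)
    rintro x ⟨hx, hxU⟩
    by_contra hxV
    exact hx (subset_lowerClosure (subset_closure ⟨hxU, hxV⟩))

theorem OpUp.directedOn_isClopen_le (U : OpUp X) :
    DirectedOn (· ≤ ·) {V : OpUp X | IsClopen V.carrier ∧ V ≤ U} := by
  rintro V ⟨hV, hVU⟩ W ⟨hW, hWU⟩
  exact ⟨V ⊔ W, ⟨by rw [OpUp.carrier_sup]; exact hV.union hW, sup_le hVU hWU⟩, le_sup_left,
    le_sup_right⟩

variable [CompactSpace X] [PriestleySpace X]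

theorem OpUp.sSup_isClopen_le (U : OpUp X) :
    sSup {V : OpUp X | IsClopen V.carrier ∧ V ≤ U} = U := by
  apply le_antisymm
  · exact sSup_le fun V hV => hV.2
  · intro x hx
    obtain ⟨V, hV, hV', hxV, hVU⟩ := exists_isClopen_upper_subset U.isOpen U.isUpperSet hx
    exact Set.mem_biUnion (x := (⟨V, hV.isOpen, hV'⟩ : OpUp X)) ⟨hV, hVU⟩ hxV

/-- An open upset is the directed union of the clopen upsets inside it, so a compact one is itself
clopen; conversely a clopen set is topologically compact. -/
theorem OpUp.isCompactElement_iff {U : OpUp X} :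
    IsCompactElement U ↔ IsClopen U.carrier := by
  rw [CompleteLattice.isCompactElement_iff_le_of_directed_sSup_le]
  constructor
  · intro h
    obtain ⟨V, ⟨hV, hVU⟩, hUV⟩ := h
      {V : OpUp X | IsClopen V.carrier ∧ V ≤ U} ⟨⊥, by rw [OpUp.carrier_bot]; exact isClopen_empty, bot_le⟩
      U.directedOn_isClopen_le U.sSup_isClopen_le.ge
    rwa [hUV.antisymm hVU]
  · intro hU S hS hd h
    have := hS.to_subtype
    obtain ⟨V, hV⟩ := hU.isClosed.isCompact.elim_directed_cover (fun V : S => V.1.carrier)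
      (fun V => V.1.isOpen) (by rw [Set.iUnion_subtype]; exact h)
      (directedOn_iff_directed.mp hd)
    exact ⟨V.1, V.2, hV⟩

end Priestley

/-- The Esakia condition enters only in `himp_mem`: for clopen `U` and `V` no closure is needed, and
`↓(U \ V)` is clopen. -/
instance {X : Type u} [TopologicalSpace X] [PartialOrder X] [EsakiaSpace X] :
    IsHeytingFrame (OpUp X) where
  exists_sSup_eq U := ⟨_, fun V hV => OpUp.isCompactElement_iff.mpr hV.1, U.sSup_isClopen_le⟩
  bot_mem := OpUp.isCompactElement_iff.mpr (by rw [OpUp.carrier_bot]; exact isClopen_empty)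
  top_mem := OpUp.isCompactElement_iff.mpr isClopen_univ
  sup_mem U V := by
    simp only [OpUp.isCompactElement_iff, OpUp.carrier_sup]
    exact IsClopen.union
  inf_mem U V := by
    simp only [OpUp.isCompactElement_iff]
    exact IsClopen.inter
  himp_mem U V := by
    simp only [OpUp.isCompactElement_iff, OpUp.carrier_himp]
    intro hU hV
    rw [(hU.diff hV).isClosed.closure_eq]
    exact (EsakiaSpace.isClopen_lowerClosure _ (hU.diff hV)).compl

/-! ### Priestley morphisms and frame homomorphisms -/

section Morphisms

variable {X : Type u} {Y : Type v} [TopologicalSpace X] [PartialOrder X] [TopologicalSpace Y]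
  [PartialOrder Y]

theorem OpUp.isCompactElement_comap [CompactSpace X] [PriestleySpace X] [CompactSpace Y]
    [PriestleySpace Y] (f : X →Co Y) (U : OpUp Y) (hU : IsCompactElement U) :
    IsCompactElement (OpUp.comap f U) :=
  OpUp.isCompactElement_iff.mpr
    ((OpUp.isCompactElement_iff.mp hU).preimage f.continuous_toFun)

theorem isEConstructible_sdiff {U V : Set X} (hU : IsOpen U) (hU' : IsUpperSet U)
    (hV : IsOpen V) (hV' : IsUpperSet V) : IsEConstructible (U \ V) :=
  ⟨{U \ V}, Set.finite_singleton _, by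
    rintro _ rfl
    exact ⟨U, V, hU, hU', hV, hV', rfl⟩, (Set.sUnion_singleton _).symm⟩

theorem lowerClosure_closure_sUnion {S : Set (Set X)} (hS : S.Finite) :
    (lowerClosure (closure (⋃₀ S)) : Set X) = ⋃ D ∈ S, (lowerClosure (closure D) : Set X) := by
  rw [hS.closure_sUnion, lowerClosure_iUnion]
  simp only [lowerClosure_iUnion, LowerSet.coe_iSup]

/-- The preimage map of a Priestley morphism preserves implication if and only if the morphism
commutes with closed downsets generated by constructible sets. -/
theorem comap_himp_iff_commutesWithClosure [CompactSpace X] [PriestleySpace X] [CompactSpace Y]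
    [PriestleySpace Y] (f : X →Co Y) :
    (∀ U V : OpUp Y, OpUp.comap f (U ⇨ V) = OpUp.comap f U ⇨ OpUp.comap f V) ↔
      CommutesWithClosure f := by
  -- Apply the formula for the complement of an implication in both spaces; preimages commute with
  -- complements and differences.
  have key : ∀ U V : OpUp Y, OpUp.comap f (U ⇨ V) = OpUp.comap f U ⇨ OpUp.comap f V ↔
      f ⁻¹' (lowerClosure (closure (U.carrier \ V.carrier)) : Set Y) =
        (lowerClosure (closure (f ⁻¹' (U.carrier \ V.carrier))) : Set X) := by
    intro U V
    rw [OpUp.ext_iff, OpUp.carrier_himp]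
    change f ⁻¹' (U ⇨ V).carrier = _ ↔ _
    rw [OpUp.carrier_himp, Set.preimage_compl, compl_inj_iff]
    rfl
  simp only [key]
  constructor
  · rintro h E ⟨S, hS, hD, rfl⟩
    rw [lowerClosure_closure_sUnion hS, Set.preimage_sUnion, ← Set.sUnion_image (Set.preimage f) S,
      lowerClosure_closure_sUnion (hS.image _), Set.biUnion_image, Set.preimage_iUnion₂]
    refine Set.iUnion₂_congr fun D hDS => ?_
    obtain ⟨U, V, hU, hU', hV, hV', rfl⟩ := hD D hDS
    exact h ⟨U, hU, hU'⟩ ⟨V, hV, hV'⟩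
  · intro h U V
    exact h _ (isEConstructible_sdiff U.isOpen U.isUpperSet V.isOpen V.isUpperSet)

theorem OpUp.comap_injective [PriestleySpace Y] {f g : X →Co Y}
    (h : ∀ U, OpUp.comap f U = OpUp.comap g U) : f = g := by
  have hle : ∀ {f g : X →Co Y}, (∀ U, OpUp.comap f U = OpUp.comap g U) → ∀ x, f x ≤ g x := by
    intro f g h x
    by_contra hx
    obtain ⟨U, hU, hU', hxU, hgU⟩ := exists_isClopen_upper_of_not_le hx
    have := congrArg OpUp.carrier (h ⟨U, hU.isOpen, hU'⟩)
    exact hgU ((Set.ext_iff.mp this x).mp hxU)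
  exact DFunLike.ext _ _ fun x => (hle h x).antisymm (hle (fun U => (h U).symm) x)

/-- The differences of clopen upsets form a base of a Priestley space: those containing a given
point are closed under intersection and meet in that point alone, so by compactness one of them fits
in any given neighbourhood. -/
theorem continuous_of_isClopen_preimage {X : Type*} [TopologicalSpace X] [CompactSpace Y]
    [PriestleySpace Y] {f : X → Y}
    (hf : ∀ V : Set Y, IsClopen V → IsUpperSet V → IsClopen (f ⁻¹' V)) : Continuous f := by
  rw [continuous_iff_continuousAt]
  intro x W hW
  rw [Filter.mem_map]
  obtain ⟨O, hOW, hO, hxO⟩ := mem_nhds_iff.mp hW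
  -- the clopen sets `U \ V` containing `f x`, with `U`, `V` clopen upsets
  let ι := {p : Set Y × Set Y // (IsClopen p.1 ∧ IsUpperSet p.1 ∧ f x ∈ p.1) ∧
    (IsClopen p.2 ∧ IsUpperSet p.2 ∧ f x ∉ p.2)}
  have : Nonempty ι := ⟨⟨(Set.univ, ∅), ⟨isClopen_univ, isUpperSet_univ, trivial⟩,
    isClopen_empty, isUpperSet_empty, id⟩⟩
  obtain ⟨⟨⟨U, V⟩, ⟨hU, hU', hxU⟩, hV, hV', hxV⟩, h⟩ :=
    hO.isClosed_compl.isCompact.elim_directed_cover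
    (fun p : ι => (p.1.1 \ p.1.2)ᶜ) (fun p => (p.2.1.1.diff p.2.2.1).compl.isOpen)
    (fun y hy => by
      have hne : f x ≠ y := fun h => hy (h ▸ hxO)
      obtain hn | hn := hne.not_le_or_not_ge
      · obtain ⟨U, hU, hU', hxU, hyU⟩ := exists_isClopen_upper_of_not_le hn
        exact Set.mem_iUnion.mpr ⟨⟨(U, ∅), ⟨hU, hU', hxU⟩, isClopen_empty, isUpperSet_empty, id⟩,
          fun h => hyU h.1⟩
      · obtain ⟨V, hV, hV', hyV, hxV⟩ := exists_isClopen_upper_of_not_le hn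
        exact Set.mem_iUnion.mpr ⟨⟨(Set.univ, V), ⟨isClopen_univ, isUpperSet_univ, trivial⟩,
          hV, hV', hxV⟩, fun h => h.2 hyV⟩)
    (fun p q => ⟨⟨(p.1.1 ∩ q.1.1, p.1.2 ∪ q.1.2),
      ⟨p.2.1.1.inter q.2.1.1, p.2.1.2.1.inter q.2.1.2.1, p.2.1.2.2, q.2.1.2.2⟩,
      p.2.2.1.union q.2.2.1, p.2.2.2.1.union q.2.2.2.1, fun h => h.elim p.2.2.2.2 q.2.2.2.2⟩,
      Set.compl_subset_compl.mpr fun y hy => ⟨hy.1.1, fun h => hy.2 (Or.inl h)⟩,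
      Set.compl_subset_compl.mpr fun y hy => ⟨hy.1.2, fun h => hy.2 (Or.inr h)⟩⟩)
  refine Filter.mem_of_superset (((hf U hU hU').diff (hf V hV hV')).isOpen.mem_nhds ⟨hxU, hxV⟩) ?_
  exact fun z hz => hOW (Set.compl_subset_compl.mp h hz)

/-- A frame homomorphism between frames of open upsets of Priestley spaces which preserves compact
elements comes from a Priestley morphism. -/
theorem OpUp.exists_comap_eq [CompactSpace X] [PriestleySpace X] [CompactSpace Y]
    [PriestleySpace Y] (φ : FrameHom (OpUp Y) (OpUp X))
    (hφ : ∀ U, IsCompactElement U → IsCompactElement (φ U)) :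
    ∃ f : X →Co Y, ∀ U, OpUp.comap f U = φ U := by
  have point : ∀ x : X, ∃ y : Y, ∀ V : OpUp Y, IsClopen V.carrier →
      (y ∈ V.carrier ↔ x ∈ (φ V).carrier) := by
    intro x
    -- `W` is the largest open upset with `x ∉ φ W`, as `φ` preserves joins. The image of `x` must
    -- lie outside `W` and in every clopen `V` with `x ∈ φ V`. The sets `V \ W` are nonempty, since
    -- `V ≤ W` would put `x` in `φ W`, and they are directed because `φ` preserves meets.
    let W : OpUp Y := sSup {V | x ∉ (φ V).carrier}
    have hW : x ∉ (φ W).carrier := by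
      rw [map_sSup, OpUp.carrier_sSup]
      intro h
      obtain ⟨_, ⟨V, hV, rfl⟩, hxV⟩ := Set.mem_iUnion₂.mp h
      exact hV hxV
    let ι := {V : OpUp Y // IsClopen V.carrier ∧ x ∈ (φ V).carrier}
    have htop : x ∈ (φ ⊤).carrier := by rw [map_top]; trivial
    have : Nonempty ι := ⟨⟨⊤, isClopen_univ, htop⟩⟩
    obtain ⟨y, hy⟩ := IsCompact.nonempty_iInter_of_directed_nonempty_isCompact_isClosed
      (fun V : ι => V.1.carrier \ W.carrier)
      (fun U V => ⟨⟨U.1 ⊓ V.1, U.2.1.inter V.2.1, by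
          rw [map_inf]; exact ⟨U.2.2, V.2.2⟩⟩,
        Set.sdiff_subset_sdiff_left Set.inter_subset_left,
        Set.sdiff_subset_sdiff_left Set.inter_subset_right⟩)
      (fun V => by
        rw [Set.sdiff_nonempty]
        intro h
        exact hW (OrderHomClass.mono φ (show V.1 ≤ W from h) V.2.2))
      (fun V => (V.2.1.isClosed.sdiff W.isOpen).isCompact)
      (fun V => V.2.1.isClosed.sdiff W.isOpen)
    rw [Set.mem_iInter] at hy
    refine ⟨y, fun V hV => ⟨fun hyV => ?_, fun hxV => (hy ⟨V, hV, hxV⟩).1⟩⟩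
    by_contra hxV
    exact (hy ⟨⊤, isClopen_univ, htop⟩).2 ((le_sSup hxV : V ≤ W) hyV)
  choose f hf using point
  have hcont : Continuous f := continuous_of_isClopen_preimage fun V hV hV' => by
    have : f ⁻¹' V = (φ ⟨V, hV.isOpen, hV'⟩).carrier :=
      Set.ext fun x => hf x ⟨V, hV.isOpen, hV'⟩ hV
    rw [this]
    exact OpUp.isCompactElement_iff.mp (hφ _ (OpUp.isCompactElement_iff.mpr hV))
  have hmono : Monotone f := by
    intro x x' hxx'
    by_contra hn
    obtain ⟨V, hV, hV', hxV, hxV'⟩ := exists_isClopen_upper_of_not_le hn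
    exact hxV' ((hf x' ⟨V, hV.isOpen, hV'⟩ hV).mpr
      ((φ _).isUpperSet hxx' ((hf x ⟨V, hV.isOpen, hV'⟩ hV).mp hxV)))
  let F : X →Co Y := ⟨⟨f, hmono⟩, hcont⟩
  refine ⟨F, fun U => ?_⟩
  have hclopen : ∀ V : OpUp Y, IsClopen V.carrier → OpUp.comap F V = φ V := fun V hV =>
    OpUp.ext (Set.ext fun x => hf x V hV)
  -- Both maps preserve joins, and `U` is a join of clopen upsets, where they agree.
  rw [← U.sSup_isClopen_le, map_sSup, map_sSup]
  exact congrArg sSup (Set.image_congr fun V hV => hclopen V hV.1)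

end Morphisms

namespace ESPlus

/-- The contravariant functor from `ES⁺` to `HeytFrm⁺` sending `X` to its frame of open upsets
and `f` to `f⁻¹`. -/
def toHeytFrmPlus : ESPlus.{u}ᵒᵖ ⥤ HeytFrmPlus.{u} where
  obj X := ⟨OpUp X.unop.carrier⟩
  map f := ⟨OpUp.comap f.unop.toContinuousOrderHom, OpUp.isCompactElement_comap _,
    (comap_himp_iff_commutesWithClosure _).mpr f.unop.commutes⟩

instance : toHeytFrmPlus.{u}.Faithful where
  map_injective h := Quiver.Hom.unop_inj (ESPlus.Hom.ext (OpUp.comap_injective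
    fun U => congrArg (fun k : HeytFrmPlus.Hom _ _ => k.toFrameHom U) h))

instance : toHeytFrmPlus.{u}.Full where
  map_surjective {X Y} φ := by
    obtain ⟨f, hf⟩ := OpUp.exists_comap_eq φ.toFrameHom φ.map_compact
    refine ⟨Quiver.Hom.op (⟨f, (comap_himp_iff_commutesWithClosure f).mp fun U V => ?_⟩ :
      ESPlus.Hom Y.unop X.unop), HeytFrmPlus.hom_ext hf⟩
    rw [hf, hf, hf]
    exact φ.map_himp U V

end ESPlus

/-! ### The Esakia space of prime filters -/

/-- The characteristic functions of prime filters of a bounded lattice, with the pointwise order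
and the topology of pointwise convergence. -/
abbrev PrimeSpec (A : Type u) [Lattice A] [BoundedOrder A] :=
  {p : A → Bool // (p ⊥ = false ∧ p ⊤ = true) ∧ ∀ a b, p (a ⊓ b) = (p a && p b) ∧
    p (a ⊔ b) = (p a || p b)}

namespace PrimeSpec

/-! ### Topology and order of the space of prime filters -/

section Lattice

variable {A : Type u} [Lattice A] [BoundedOrder A]

theorem apply_mono (p : PrimeSpec A) {a b : A} (h : a ≤ b) (ha : p.1 a = true) :
    p.1 b = true := by
  rw [← sup_eq_right.mpr h, (p.2.2 a b).2, ha, Bool.true_or]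

theorem continuous_apply (a : A) : Continuous fun p : PrimeSpec A => p.1 a :=
  (_root_.continuous_apply a).comp continuous_subtype_val

theorem isClopen_apply_eq (a : A) (i : Bool) : IsClopen {p : PrimeSpec A | p.1 a = i} :=
  (isClopen_discrete {i}).preimage (continuous_apply a)

theorem isUpperSet_apply_eq_true (a : A) : IsUpperSet {p : PrimeSpec A | p.1 a = true} :=
  fun _ _ hpq hp => top_le_iff.mp (hp.symm.trans_le (hpq a))

theorem le_iff {p q : PrimeSpec A} : p ≤ q ↔ ∀ a, p.1 a = true → q.1 a = true :=
  ⟨fun h _ ha => top_le_iff.mp (ha.symm.trans_le (h _)), fun h a => Bool.le_iff_imp.mpr (h a)⟩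

/-- The defining equations cut out a closed subset of the compact product `A → Bool`. -/
instance : CompactSpace (PrimeSpec A) := by
  suffices h : IsClosed {p : A → Bool | (p ⊥ = false ∧ p ⊤ = true) ∧
      ∀ a b, p (a ⊓ b) = (p a && p b) ∧ p (a ⊔ b) = (p a || p b)} from
    isCompact_iff_compactSpace.mp h.isCompact
  have hc : ∀ a : A, Continuous fun p : A → Bool => p a := _root_.continuous_apply
  have h2 : ∀ (f : Bool → Bool → Bool) (a b : A), Continuous fun p : A → Bool => f (p a) (p b) :=
    fun f a b => (continuous_of_discreteTopology (f := fun x : Bool × Bool => f x.1 x.2)).comp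
      ((hc a).prodMk (hc b))
  simp only [Set.ofPred_and, Set.ofPred_forall]
  exact ((isClosed_eq (hc _) continuous_const).inter (isClosed_eq (hc _) continuous_const)).inter
    (isClosed_iInter fun a => isClosed_iInter fun b =>
      (isClosed_eq (hc _) (h2 and a b)).inter (isClosed_eq (hc _) (h2 or a b)))

instance : PriestleySpace (PrimeSpec A) where
  priestley {p q} h := by
    rw [le_iff] at h
    push Not at h
    obtain ⟨a, ha, hb⟩ := h
    exact ⟨_, isClopen_apply_eq a true, isUpperSet_apply_eq_true a, ha, hb⟩

/-- A basic neighbourhood prescribes finitely many values. Primeness merges them: the values `true`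
into one at a meet, the values `false` into one at a join. -/
theorem exists_basic_subset {W : Set (PrimeSpec A)} (hW : IsOpen W) {p : PrimeSpec A}
    (hp : p ∈ W) : ∃ a b, p.1 a = true ∧ p.1 b = false ∧
      ∀ q : PrimeSpec A, q.1 a = true → q.1 b = false → q ∈ W := by
  obtain ⟨O, hO, rfl⟩ := isOpen_induced_iff.mp hW
  obtain ⟨I, u, hu, hIu⟩ := isOpen_pi_iff.mp hO p.1 hp
  have : ∃ a b, p.1 a = true ∧ p.1 b = false ∧
      ∀ q : PrimeSpec A, q.1 a = true → q.1 b = false → ∀ i ∈ I, q.1 i = p.1 i := by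
    clear hu hIu
    classical
    induction I using Finset.induction_on with
    | empty => exact ⟨⊤, ⊥, p.2.1.2, p.2.1.1, fun q _ _ i hi => by simp at hi⟩
    | insert c I _ ih =>
      obtain ⟨a, b, ha, hb, h⟩ := ih
      cases hc : p.1 c with
      | true =>
        refine ⟨a ⊓ c, b, by rw [(p.2.2 a c).1, ha, hc]; rfl, hb, fun q hqa hqb i hi => ?_⟩
        rw [(q.2.2 a c).1, Bool.and_eq_true] at hqa
        obtain rfl | hi := Finset.mem_insert.mp hi
        · rw [hqa.2, hc]
        · exact h q hqa.1 hqb i hi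
      | false =>
        refine ⟨a, b ⊔ c, ha, by rw [(p.2.2 b c).2, hb, hc]; rfl, fun q hqa hqb i hi => ?_⟩
        rw [(q.2.2 b c).2, Bool.or_eq_false_iff] at hqb
        obtain rfl | hi := Finset.mem_insert.mp hi
        · rw [hqb.2, hc]
        · exact h q hqa hqb.1 i hi
  obtain ⟨a, b, ha, hb, h⟩ := this
  exact ⟨a, b, ha, hb, fun q hqa hqb => hIu fun i hi => by
    rw [h q hqa hqb i hi]; exact (hu i hi).2⟩

end Lattice

/-! ### Ideals as open upsets of prime filters -/

section DistribLattice

variable {A : Type u} [DistribLattice A] [BoundedOrder A]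

/-- The prime filter complementary to a prime ideal. -/
noncomputable def ofIsPrime (J : Order.Ideal A) (hJ : J.IsPrime) : PrimeSpec A := by
  classical
  refine ⟨fun a => decide (a ∉ J), ⟨by simp, ?_⟩, fun a b => ⟨?_, ?_⟩⟩
  · simpa using (Order.Ideal.isProper_iff_top_notMem.mp hJ.toIsProper)
  · have : a ⊓ b ∈ J ↔ a ∈ J ∨ b ∈ J :=
      ⟨hJ.mem_or_mem, fun h => h.elim (J.lower inf_le_left) (J.lower inf_le_right)⟩
    simp [this]
  · simp [Order.Ideal.sup_mem_iff, Bool.decide_or, imp_iff_not_or]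

theorem ofIsPrime_apply_eq_true {J : Order.Ideal A} {hJ : J.IsPrime} {a : A} :
    (ofIsPrime J hJ).1 a = true ↔ a ∉ J := by
  simp [ofIsPrime]

/-- A filter and an ideal which are disjoint are separated by a prime filter. -/
theorem exists_separating (F : Order.PFilter A) (I : Order.Ideal A)
    (h : Disjoint (F : Set A) (I : Set A)) :
    ∃ p : PrimeSpec A, (∀ a ∈ F, p.1 a = true) ∧ ∀ a ∈ I, p.1 a = false := by
  obtain ⟨J, hJ, hIJ, hFJ⟩ := DistribLattice.prime_ideal_of_disjoint_filter_ideal h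
  refine ⟨ofIsPrime J hJ, fun a ha => ?_, fun a ha => ?_⟩
  · exact ofIsPrime_apply_eq_true.mpr (Set.disjoint_left.mp hFJ ha)
  · rw [← Bool.not_eq_true, ofIsPrime_apply_eq_true, not_not]
    exact hIJ ha

/-- The open upset of prime filters which meet the ideal `I`. -/
def openOfIdeal (I : Order.Ideal A) : OpUp (PrimeSpec A) where
  carrier := ⋃ a ∈ I, {p | p.1 a = true}
  isOpen := isOpen_biUnion fun a _ => (isClopen_apply_eq a true).isOpen
  isUpperSet := isUpperSet_iUnion₂ fun a _ => isUpperSet_apply_eq_true a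

theorem mem_openOfIdeal {I : Order.Ideal A} {p : PrimeSpec A} :
    p ∈ (openOfIdeal I).carrier ↔ ∃ a ∈ I, p.1 a = true := by
  simp [openOfIdeal]

/-- Reflecting the order is the prime filter theorem: if `a ∈ I` is not in `J`, some prime filter
contains `a` and misses `J`. -/
theorem openOfIdeal_le_iff {I J : Order.Ideal A} : openOfIdeal I ≤ openOfIdeal J ↔ I ≤ J := by
  constructor
  · intro h a ha
    by_contra haJ
    obtain ⟨p, hp, hpJ⟩ := exists_separating (Order.PFilter.principal a) J
      (Set.disjoint_left.mpr fun b hb hbJ => haJ (J.lower hb hbJ))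
    obtain ⟨b, hb, hpb⟩ := mem_openOfIdeal.mp
      (h (mem_openOfIdeal.mpr ⟨a, ha, hp a (Order.PFilter.mem_principal.mpr le_rfl)⟩))
    rw [hpJ b hb] at hpb
    exact Bool.false_ne_true hpb
  · intro h p hp
    obtain ⟨a, ha, hpa⟩ := mem_openOfIdeal.mp hp
    exact mem_openOfIdeal.mpr ⟨a, h ha, hpa⟩

/-- Each `q ∉ U` fails to be above `p`, so it omits some `a ∈ p`. Compactness of the complement of
`U`, with `p` closed under meets, gives one `a` for all such `q`. -/
theorem exists_apply_subset {U : Set (PrimeSpec A)} (hU : IsOpen U) (hU' : IsUpperSet U)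
    {p : PrimeSpec A} (hp : p ∈ U) :
    ∃ a, p.1 a = true ∧ ∀ q : PrimeSpec A, q.1 a = true → q ∈ U := by
  let ι := {a : A // p.1 a = true}
  have : Nonempty ι := ⟨⟨⊤, p.2.1.2⟩⟩
  obtain ⟨⟨a, ha⟩, h⟩ := hU.isClosed_compl.isCompact.elim_directed_cover
    (fun a : ι => {q : PrimeSpec A | q.1 a.1 = false}) (fun a => (isClopen_apply_eq _ _).isOpen)
    (fun q hq => by
      have hpq : ¬ p ≤ q := fun h => hq (hU' h hp)
      rw [le_iff] at hpq
      push Not at hpq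
      obtain ⟨a, ha, hqa⟩ := hpq
      exact Set.mem_iUnion.mpr ⟨⟨a, ha⟩, Bool.eq_false_iff.mpr hqa⟩)
    (fun a b => ⟨⟨a.1 ⊓ b.1, by rw [(p.2.2 _ _).1, a.2, b.2]; rfl⟩,
      fun q (hq : q.1 a.1 = false) => by
        change q.1 (a.1 ⊓ b.1) = false
        rw [(q.2.2 _ _).1, hq, Bool.false_and],
      fun q (hq : q.1 b.1 = false) => by
        change q.1 (a.1 ⊓ b.1) = false
        rw [(q.2.2 _ _).1, hq, Bool.and_false]⟩)
  refine ⟨a, ha, fun q hq => ?_⟩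
  by_contra hqU
  exact Bool.false_ne_true ((h hqU).symm.trans hq)

theorem openOfIdeal_surjective : Function.Surjective (openOfIdeal (A := A)) := by
  intro U
  refine ⟨⟨⟨{a | ∀ q : PrimeSpec A, q.1 a = true → q ∈ U.carrier}, ?_⟩, ?_, ?_⟩, ?_⟩
  · exact fun a b hba ha q hq => ha q (apply_mono q hba hq)
  · exact ⟨⊥, fun q hq => absurd (q.2.1.1.symm.trans hq) Bool.false_ne_true⟩
  · refine fun a ha b hb => ⟨a ⊔ b, fun q hq => ?_, le_sup_left, le_sup_right⟩
    rw [(q.2.2 a b).2, Bool.or_eq_true] at hq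
    exact hq.elim (ha q) (hb q)
  · refine OpUp.ext (Set.ext fun p => mem_openOfIdeal.trans
      ⟨fun ⟨a, ha, hpa⟩ => ha p hpa, fun hp => ?_⟩)
    obtain ⟨a, hpa, ha⟩ := exists_apply_subset U.isOpen U.isUpperSet hp
    exact ⟨a, ha, hpa⟩

/-- The frame of ideals of `A` is isomorphic to the frame of open upsets of the space of prime
filters of `A`. -/
noncomputable def openOfIdealIso : Order.Ideal A ≃o OpUp (PrimeSpec A) :=
  RelIso.ofSurjective (OrderEmbedding.ofMapLEIff openOfIdeal fun _ _ => openOfIdeal_le_iff)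
    openOfIdeal_surjective

end DistribLattice

/-! ### The Esakia property of the space of prime filters -/

section HeytingAlgebra

variable {A : Type u} [HeytingAlgebra A]

theorem exists_le_of_himp_eq_false (p : PrimeSpec A) {a b : A} (h : p.1 (a ⇨ b) = false) :
    ∃ q, p ≤ q ∧ q.1 a = true ∧ q.1 b = false := by
  -- `F` is the filter generated by `p` and `a`. It misses `↓b`, since `c ⊓ a ≤ b` with `c ∈ p`
  -- would force `a ⇨ b ∈ p`.
  let F : Set A := {x | ∃ c, p.1 c = true ∧ c ⊓ a ≤ x}
  have hF : Order.IsPFilter F := Order.IsPFilter.of_def ⟨⊤, ⊤, p.2.1.2, le_top⟩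
    (by
      rintro x ⟨c, hc, hx⟩ y ⟨d, hd, hy⟩
      refine ⟨c ⊓ d ⊓ a, ⟨c ⊓ d, by rw [(p.2.2 c d).1, hc, hd]; rfl, le_rfl⟩, ?_, ?_⟩
      · exact (inf_le_inf_right a inf_le_left).trans hx
      · exact (inf_le_inf_right a inf_le_right).trans hy)
    (fun {x y} hxy ⟨c, hc, hx⟩ => ⟨c, hc, hx.trans hxy⟩)
  obtain ⟨q, hqF, hqb⟩ := exists_separating hF.toPFilter (Order.Ideal.principal b)
    (Set.disjoint_left.mpr fun x ⟨c, hc, hx⟩ hxb => by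
      have := apply_mono p (le_himp_iff.mpr (hx.trans hxb)) hc
      exact Bool.false_ne_true (h.symm.trans this))
  refine ⟨q, le_iff.mpr fun c hc => hqF c ⟨c, hc, inf_le_left⟩, hqF a ⟨⊤, p.2.1.2, inf_le_right⟩,
    hqb b Order.Ideal.mem_principal_self⟩

/-- The downset of the basic set "contains `a`, omits `b`" is the clopen set "omits `a ⇨ b`", so
downsets of open sets are open; downsets of closed sets are always closed. -/
instance : EsakiaSpace (PrimeSpec A) where
  isClopen_lowerClosure W hW := by
    refine ⟨isClosed_lowerClosure_of_isClosed hW.isClosed, isOpen_iff_forall_mem_open.mpr ?_⟩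
    intro p hp
    obtain ⟨q, hq, hpq⟩ := mem_lowerClosure.mp hp
    obtain ⟨a, b, hqa, hqb, hab⟩ := exists_basic_subset hW.isOpen hq
    refine ⟨{r | r.1 (a ⇨ b) = false}, fun r hr => ?_, (isClopen_apply_eq _ _).isOpen, ?_⟩
    · obtain ⟨s, hrs, hsa, hsb⟩ := exists_le_of_himp_eq_false r hr
      exact mem_lowerClosure.mpr ⟨s, hab s hsa hsb, hrs⟩
    · by_contra hn
      have hq' := le_iff.mp hpq _ ((Bool.not_eq_false _).mp hn)
      have := apply_mono q (himp_inf_le : (a ⇨ b) ⊓ a ≤ b)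
        (by rw [(q.2.2 _ _).1, hq', hqa]; rfl)
      exact Bool.false_ne_true (hqb.symm.trans this)

end HeytingAlgebra

end PrimeSpec

instance : ESPlus.toHeytFrmPlus.{u}.EssSurj where
  mem_essImage L := ⟨Opposite.op ⟨PrimeSpec (Compacts L.carrier)⟩,
    ⟨HeytFrmPlus.isoOfOrderIso
      ((compactsBelowIso L.carrier).trans PrimeSpec.openOfIdealIso).symm⟩⟩

instance : ESPlus.toHeytFrmPlus.{u}.IsEquivalence where

end HeytingFrames

theorem corollary3p14 :
    (∃ e : HeytingFrames.HAPlus.{u} ≌ HeytingFrames.HeytFrmPlus.{u},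
      Nonempty (e.functor ⋙ HeytingFrames.HeytFrmPlus.forgetToFrm ≅
        HeytingFrames.HAPlus.idealFunctor)) ∧
    (∃ d : HeytingFrames.ESPlus.{u}ᵒᵖ ≌ HeytingFrames.HeytFrmPlus.{u},
      Nonempty (d.functor ⋙ HeytingFrames.HeytFrmPlus.forgetToFrm ≅
        HeytingFrames.ESPlus.opUpFunctor)) ∧
    (∀ (X : Type u) (Y : Type v) [TopologicalSpace X] [PartialOrder X]
      [HeytingFrames.EsakiaSpace X] [TopologicalSpace Y] [PartialOrder Y]
      [HeytingFrames.EsakiaSpace Y] (f : X →Co Y),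
      (∀ U V : HeytingFrames.OpUp Y, HeytingFrames.OpUp.comap f (U ⇨ V) =
        HeytingFrames.OpUp.comap f U ⇨ HeytingFrames.OpUp.comap f V) ↔
      HeytingFrames.CommutesWithClosure f) :=
  -- After forgetting to frames, both functors agree definitionally with the prescribed ones, so
  -- identity isomorphisms suffice.
  ⟨⟨HeytingFrames.HAPlus.toHeytFrmPlus.asEquivalence, ⟨Iso.refl _⟩⟩,
    ⟨HeytingFrames.ESPlus.toHeytFrmPlus.asEquivalence, ⟨Iso.refl _⟩⟩,
    fun _ _ _ _ _ _ _ _ f => HeytingFrames.comap_himp_iff_commutesWithClosure f⟩
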